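/- Let $T$ be a consistent theory, i.e. a consistent set of first-order sentences, in the language $\{0,S,+,\cdot\}$ of arithmetic, and suppose that $T$ contains Robinson's arithmetic $Q$ (every axiom of $Q$ is provable in $T$). For a sentence $\psi$ let $\#\psi$ be the numeral of its Gödel number (for a fixed standard Gödel numbering). For a predicate, i.e. an arithmetical formula $\Delta(x)$ with the single free variable $x$, say that $\psi$ \emph{asserts inside $T$ that it is $\Delta$} if $T\vdash\psi\leftrightarrow\Delta(\#\psi)$. Call $\Delta$ \emph{self-fulfilling} with respect to $T$ if $\mathbb{N}\vDash\Delta(\#\psi)$ for every sentence $\psi$ with $T\vdash\psi\leftrightarrow\Delta(\#\psi)$, and call $\Theta$ \emph{self-falsifying} with respect to $T$ if $\mathbb{N}\nvDash\Theta(\#\psi)$ for every sentence $\psi$ with $T\vdash\psi\leftrightarrow\Theta(\#\psi)$. Let $\Delta$ be self-fulfilling and $\Theta$ self-falsifying with respect to $T$. Then the following are equivalent: (i) $T$ is sound, i.e. every sentence provable in $T$ is true in the standard model $\mathbb{N}$; (ii) every sentence $\psi$ with $T\vdash\psi\leftrightarrow\Delta(\#\psi)$ is true in $\mathbb{N}$;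 (iii) every sentence $\psi$ with $T\vdash\psi\leftrightarrow\Theta(\#\psi)$ is false in $\mathbb{N}$. -/

import Mathlib

open FirstOrder

/-! ### First-order provability -/

namespace FirstOrder.Language

universe u v

variable {L : Language.{u, v}}

/-- `instantiate φ t` is `φ(t)`: the term `t` is substituted for the variable of `φ` that the
quantifier of `∀' φ` binds. The free variables `x₀, x₁, …` are indexed by `ℕ`; they are kept apart
from the bound ones, so nothing is captured. -/
def instantiate (φ : L.BoundedFormula ℕ 1) (t : L.Term ℕ) : L.Formula ℕ :=
  BoundedFormula.subst φ.toFormula (Sum.elim Term.var fun _ => t)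

/-- A Hilbert-style calculus for classical first-order logic with equality: `Derivable T φ` says
that the formula `φ` has a formal proof from the sentences in `T`. The primitive connectives are
`⊥`, `→`, `∀` (negation is `φ → ⊥`), and the rules are modus ponens and the rule
`χ → φ(xₖ) / χ → ∀x φ(x)` for `xₖ` not free in `χ` and `∀x φ(x)`. -/
inductive Derivable (T : L.Theory) : L.Formula ℕ → Prop
  | theoryAxiom (σ : L.Sentence) : σ ∈ T → Derivable T (Formula.relabel Empty.elim σ)
  | implyK (φ χ : L.Formula ℕ) : Derivable T (φ.imp (χ.imp φ))
  | implyS (φ χ θ : L.Formula ℕ) :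
      Derivable T ((φ.imp (χ.imp θ)).imp ((φ.imp χ).imp (φ.imp θ)))
  | doubleNeg (φ : L.Formula ℕ) : Derivable T (φ.not.not.imp φ)
  | allElim (φ : L.BoundedFormula ℕ 1) (t : L.Term ℕ) :
      Derivable T (φ.all.imp (instantiate φ t))
  | eqRefl (t : L.Term ℕ) : Derivable T (t.equal t)
  | eqSubst (φ : L.BoundedFormula ℕ 1) (s t : L.Term ℕ) :
      Derivable T ((s.equal t).imp ((instantiate φ s).imp (instantiate φ t)))
  | modusPonens (φ χ : L.Formula ℕ) :
      Derivable T (φ.imp χ) → Derivable T φ → Derivable T χ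
  | allIntro (χ : L.Formula ℕ) (φ : L.BoundedFormula ℕ 1) (k : ℕ) :
      k ∉ χ.freeVarFinset → k ∉ φ.freeVarFinset →
      Derivable T (χ.imp (instantiate φ (Term.var k))) → Derivable T (χ.imp φ.all)

/-- `T ⊢ σ` for a sentence `σ`. -/
def Theory.Proves (T : L.Theory) (σ : L.Sentence) : Prop :=
  Derivable T (Formula.relabel Empty.elim σ)

/-- `T` is consistent: it does not prove `⊥`. -/
def Theory.Consistent (T : L.Theory) : Prop :=
  ¬ T.Proves BoundedFormula.falsum

end FirstOrder.Language

/-! ### The language of arithmetic, its standard model and Robinson's `Q` -/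

namespace Arithmetic

open FirstOrder.Language

/-- The function symbols of the language of arithmetic. -/
inductive Func : ℕ → Type
  | zero : Func 0
  | succ : Func 1
  | add : Func 2
  | mul : Func 2

/-- The language of arithmetic: `0`, `S`, `+`, `·` (and equality). -/
def arith : Language where
  Functions := Func
  Relations := fun _ => Empty

section Terms

variable {α : Type}

/-- The constant `0`. -/
def zeroT : arith.Term α := Term.func Func.zero ![]

/-- The successor of a term. -/
def succT (t : arith.Term α) : arith.Term α := Term.func Func.succ ![t]

/-- The sum of two terms. -/
def addT (s t : arith.Term α) : arith.Term α := Term.func Func.add ![s, t]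

/-- The product of two terms. -/
def mulT (s t : arith.Term α) : arith.Term α := Term.func Func.mul ![s, t]

/-- The numeral `S(S(⋯S(0)⋯))` with `n` occurrences of `S`. -/
def numeral : ℕ → arith.Term α
  | 0 => zeroT
  | n + 1 => succT (numeral n)

end Terms

/-- The standard model `ℕ`. -/
instance standardModel : arith.Structure ℕ where
  funMap {_} f x := match f, x with
    | Func.zero, _ => 0
    | Func.succ, x => x 0 + 1
    | Func.add, x => x 0 + x 1
    | Func.mul, x => x 0 * x 1
  RelMap {_} r _ := r.elim

/-- A sentence is true if it holds in the standard model `ℕ`. -/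
def IsTrue (σ : arith.Sentence) : Prop := Sentence.Realize ℕ σ

/-- Robinson's arithmetic `Q`. -/
def robinsonQ : arith.Theory :=
  { -- `∀ x, S x ≠ 0`
    ∀' ∼(succT (&0) =' zeroT),
    -- `∀ x y, S x = S y → x = y`
    ∀' ∀' ((succT (&0) =' succT (&1)) ⟹ (&0 =' &1)),
    -- `∀ x, x ≠ 0 → ∃ y, x = S y`
    ∀' (∼(&0 =' zeroT) ⟹ ∃' (&0 =' succT (&1))),
    -- `∀ x, x + 0 = x`
    ∀' (addT (&0) zeroT =' &0),
    -- `∀ x y, x + S y = S (x + y)`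
    ∀' ∀' (addT (&0) (succT (&1)) =' succT (addT (&0) (&1))),
    -- `∀ x, x · 0 = 0`
    ∀' (mulT (&0) zeroT =' zeroT),
    -- `∀ x y, x · S y = x · y + x`
    ∀' ∀' (mulT (&0) (succT (&1)) =' addT (mulT (&0) (&1)) (&0)) }

/-! ### Gödel numbers -/

/-- The Gödel number of a term, by recursion with Cantor-style pairing. -/
def termCode {n : ℕ} : arith.Term (Empty ⊕ Fin n) → ℕ
  | Term.var (Sum.inr i) => Nat.pair 0 i
  | Term.func Func.zero _ => Nat.pair 1 0
  | Term.func Func.succ ts => Nat.pair 2 (termCode (ts 0))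
  | Term.func Func.add ts => Nat.pair 3 (Nat.pair (termCode (ts 0)) (termCode (ts 1)))
  | Term.func Func.mul ts => Nat.pair 4 (Nat.pair (termCode (ts 0)) (termCode (ts 1)))

/-- The Gödel number of a formula. -/
def code : {n : ℕ} → arith.BoundedFormula Empty n → ℕ
  | _, BoundedFormula.falsum => Nat.pair 0 0
  | _, BoundedFormula.equal s t => Nat.pair 1 (Nat.pair (termCode s) (termCode t))
  | _, BoundedFormula.rel R _ => Empty.elim R
  | _, BoundedFormula.imp φ χ => Nat.pair 2 (Nat.pair (code φ) (code χ))
  | _, BoundedFormula.all φ => Nat.pair 3 (code φ)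

/-- A predicate is a formula `Δ(x)` of arithmetic with one free variable; `apply Δ ψ` is the
sentence `Δ(#ψ)`, where `#ψ` is the numeral of the Gödel number of `ψ`. -/
def apply (Δ : arith.Formula (Fin 1)) (ψ : arith.Sentence) : arith.Sentence :=
  BoundedFormula.subst Δ fun _ => numeral (code ψ)

/-! ### Self-reference -/

/-- `ψ` asserts inside `T` that it is a `Δ`: `T ⊢ ψ ↔ Δ(#ψ)`. -/
def AssertsOfItself (T : arith.Theory) (ψ : arith.Sentence) (Δ : arith.Formula (Fin 1)) : Prop :=
  T.Proves (BoundedFormula.iff ψ (apply Δ ψ))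

/-- Every sentence that asserts inside `T` that it is a `Δ` is indeed a `Δ`. -/
def SelfFulfilling (T : arith.Theory) (Δ : arith.Formula (Fin 1)) : Prop :=
  ∀ ψ : arith.Sentence, AssertsOfItself T ψ Δ → IsTrue (apply Δ ψ)

/-- Every sentence that asserts inside `T` that it is a `Θ` is indeed not a `Θ`. -/
def SelfFalsifying (T : arith.Theory) (Θ : arith.Formula (Fin 1)) : Prop :=
  ∀ ψ : arith.Sentence, AssertsOfItself T ψ Θ → ¬ IsTrue (apply Θ ψ)

/-- `T` is sound: all its theorems are true. -/
def Sound (T : arith.Theory) : Prop :=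
  ∀ σ : arith.Sentence, T.Proves σ → IsTrue σ

/-- `T` contains `Q`: it proves all axioms of `Q`. -/
def ExtendsQ (T : arith.Theory) : Prop :=
  ∀ σ ∈ robinsonQ, T.Proves σ

end Arithmetic

/-! If `T` is sound, a sentence asserting of itself that it is `Δ` is equivalent in `ℕ` to a
statement that self-fulfilment makes true; dually for `Θ`. Conversely, let `T` prove a false `σ`. A
fixed point `ψ` of `σ ∧ Δ(x)` is false because `σ` is; yet `T` proves `σ`, so inside `T` the
sentence `ψ` merely says `Δ(#ψ)`. This refutes (ii). A fixed point of `σ → Θ(x)` is true because `σ`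
is false, while inside `T` it says `Θ(#ψ)`; this refutes (iii).

The fixed points come from the diagonal lemma `exists_fixedPoint`, stated semantically: the
equivalence holds in every model of `Q`. Gödel's completeness theorem,
`Theory.exists_model_of_not_proves`, turns this into provability in `T`, so no derivations inside
`Q` are needed.

The fixed point is `∀ x, S x = #(m + 1) → φ(x)` with `m` the code of `φ`. Its code is a polynomial
in `m` and the code of the numeral of `m + 1`, which arises by iterating `z ↦ z² + 2`. Only this
iteration needs the `β` function, and `IsQModel.isIter_num_iff` shows that its definition is correct
at standard arguments in all models of `Q`. -/

namespace FirstOrder.Language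

universe u v

variable {L : Language.{u, v}}

/-! ### Simultaneous substitution for free and bound variables -/

namespace Term

variable {α β γ : Type*}

theorem subst_subst (t : L.Term α) (f : α → L.Term β) (g : β → L.Term γ) :
    (t.subst f).subst g = t.subst fun a => (f a).subst g := by
  induction t with
  | var => rfl
  | func _ _ ih => simp only [subst, ih]

theorem subst_var (t : L.Term α) : t.subst var = t := by
  induction t with
  | var => rfl
  | func _ _ ih => simp only [subst, ih]

theorem relabel_eq_subst (t : L.Term α) (g : α → β) : t.relabel g = t.subst fun a => var (g a) := by
  induction t with
  | var => rfl
  | func _ _ ih => simp only [relabel, subst, ih]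

end Term

namespace BoundedFormula

variable {α β γ : Type*} {k l m : ℕ}

/-- Extend a substitution under a quantifier: the new bound variable is left alone. -/
def liftSubst (f : α ⊕ Fin k → L.Term (β ⊕ Fin l)) :
    α ⊕ Fin (k + 1) → L.Term (β ⊕ Fin (l + 1)) :=
  Sum.elim (fun a => (f (Sum.inl a)).relabel (Sum.map id Fin.castSucc))
    (Fin.lastCases (Term.var (Sum.inr (Fin.last l)))
      fun i => (f (Sum.inr i)).relabel (Sum.map id Fin.castSucc))

/-- Simultaneous substitution of terms for the free variables and the variables that are still
to be bound. -/
def substAll : {k : ℕ} → L.BoundedFormula α k → {l : ℕ} → (α ⊕ Fin k → L.Term (β ⊕ Fin l)) →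
    L.BoundedFormula β l
  | _, falsum, _, _ => falsum
  | _, equal t₁ t₂, _, f => equal (t₁.subst f) (t₂.subst f)
  | _, rel R ts, _, f => rel R fun i => (ts i).subst f
  | _, imp φ χ, _, f => imp (φ.substAll f) (χ.substAll f)
  | _, all φ, _, f => all (φ.substAll (liftSubst f))

theorem liftSubst_inl (f : α ⊕ Fin k → L.Term (β ⊕ Fin l)) (a : α) :
    liftSubst f (Sum.inl a) = (f (Sum.inl a)).relabel (Sum.map id Fin.castSucc) := rfl

theorem liftSubst_castSucc (f : α ⊕ Fin k → L.Term (β ⊕ Fin l)) (i : Fin k) :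
    liftSubst f (Sum.inr i.castSucc) = (f (Sum.inr i)).relabel (Sum.map id Fin.castSucc) := by
  simp [liftSubst]

theorem liftSubst_last (f : α ⊕ Fin k → L.Term (β ⊕ Fin l)) :
    liftSubst f (Sum.inr (Fin.last k)) = Term.var (Sum.inr (Fin.last l)) := by
  simp [liftSubst]

/-- Functions on the variables of a formula in the scope of one more quantifier agree if they agree
on the old variables and on the new one. -/
theorem funext_sum_last {X : Type*} {f g : α ⊕ Fin (k + 1) → X}
    (hl : ∀ a, f (Sum.inl a) = g (Sum.inl a))
    (hr : ∀ i : Fin k, f (Sum.inr i.castSucc) = g (Sum.inr i.castSucc))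
    (h : f (Sum.inr (Fin.last k)) = g (Sum.inr (Fin.last k))) : f = g := by
  funext x
  rcases x with a | i
  · exact hl a
  · induction i using Fin.lastCases with
    | last => exact h
    | cast i => exact hr i

theorem liftSubst_var :
    liftSubst (fun x : α ⊕ Fin k => (Term.var x : L.Term (α ⊕ Fin k))) = Term.var :=
  funext_sum_last (fun _ => rfl) (fun i => by simp [liftSubst_castSucc]) (liftSubst_last _)

theorem liftSubst_subst (f : α ⊕ Fin k → L.Term (β ⊕ Fin l)) (g : β ⊕ Fin l → L.Term (γ ⊕ Fin m)) :
    (fun x => (liftSubst f x).subst (liftSubst g)) = liftSubst fun x => (f x).subst g := by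
  have key (t : L.Term (β ⊕ Fin l)) :
      (t.relabel (Sum.map id Fin.castSucc)).subst (liftSubst g) =
        (t.subst g).relabel (Sum.map id Fin.castSucc) := by
    rw [Term.relabel_eq_subst, Term.relabel_eq_subst, Term.subst_subst, Term.subst_subst]
    congr 1
    funext x
    rcases x with b | i
    · simp [Term.subst, liftSubst_inl, Term.relabel_eq_subst]
    · simp [Term.subst, liftSubst_castSucc, Term.relabel_eq_subst]
  refine funext_sum_last (fun a => ?_) (fun i => ?_) ?_
  · simp only [liftSubst_inl, key]
  · simp only [liftSubst_castSucc, key]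
  · simp only [liftSubst_last, Term.subst]

/-- `subst`, `relabel` and `toFormula` are all special cases of `substAll`, so with this composition
law an identity between them reduces to comparing two functions on variables. -/
theorem substAll_substAll (φ : L.BoundedFormula α k) (f : α ⊕ Fin k → L.Term (β ⊕ Fin l))
    (g : β ⊕ Fin l → L.Term (γ ⊕ Fin m)) :
    (φ.substAll f).substAll g = φ.substAll fun x => (f x).subst g := by
  induction φ generalizing l m with
  | falsum => rfl
  | equal => simp only [substAll, Term.subst_subst]
  | rel => simp only [substAll, Term.subst_subst]
  | imp _ _ ih₁ ih₂ => simp only [substAll, ih₁, ih₂]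
  | all _ ih => simp only [substAll, ih, liftSubst_subst]

theorem substAll_var (φ : L.BoundedFormula α k) : φ.substAll Term.var = φ := by
  induction φ with
  | falsum => rfl
  | equal => simp only [substAll, Term.subst_var]
  | rel => simp only [substAll, Term.subst_var]
  | imp _ _ ih₁ ih₂ => simp only [substAll, ih₁, ih₂]
  | all _ ih => simp only [substAll, liftSubst_var, ih]

theorem subst_eq_substAll (φ : L.BoundedFormula α k) (f : α → L.Term β) :
    φ.subst f =
      φ.substAll (Sum.elim (fun a => (f a).relabel Sum.inl) fun i => Term.var (Sum.inr i)) := by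
  have lift (k : ℕ) : liftSubst (Sum.elim (fun a => (f a).relabel Sum.inl)
      fun i : Fin k => (Term.var (Sum.inr i) : L.Term (β ⊕ Fin k))) =
      Sum.elim (fun a => (f a).relabel Sum.inl) fun i => Term.var (Sum.inr i) :=
    funext_sum_last (fun a => by simp [liftSubst_inl, Term.relabel_relabel]; rfl)
      (fun i => by simp [liftSubst_castSucc]) (liftSubst_last _)
  induction φ with
  | falsum => rfl
  | equal => rfl
  | rel => rfl
  | imp _ _ ih₁ ih₂ => exact congrArg₂ imp ih₁ ih₂
  | all _ ih =>
    simp only [substAll, lift]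
    exact congrArg all ih

theorem relabel_eq_substAll (φ : L.BoundedFormula α k) (g : α → β ⊕ Fin m) :
    φ.relabel g = φ.substAll fun x => Term.var (relabelAux g k x) := by
  have lift (k : ℕ) :
      liftSubst (fun x => (Term.var (relabelAux g k x) : L.Term (β ⊕ Fin (m + k)))) =
        fun x => Term.var (relabelAux g (k + 1) x) := by
    refine funext_sum_last (fun a => ?_) (fun i => ?_) ?_
    · rw [liftSubst_inl]
      simp only [relabelAux, Function.comp, Sum.map_inl, Term.relabel]
      rcases g a with b | i <;> simp
      rfl
    · rw [liftSubst_castSucc]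
      simp [relabelAux]
    · rw [liftSubst_last]
      simp [relabelAux]
  induction φ with
  | falsum => rfl
  | equal => simp only [relabel, mapTermRel, substAll, Term.relabel_eq_subst]
  | rel => simp only [relabel, mapTermRel, substAll, Term.relabel_eq_subst]; rfl
  | imp _ _ ih₁ ih₂ => simp only [relabel_imp, ih₁, ih₂, substAll]
  | all _ ih =>
    rw [relabel_all, ih, substAll, lift]

theorem toFormula_eq_substAll (φ : L.BoundedFormula α k) :
    φ.toFormula = φ.substAll fun x => Term.var (Sum.inl x) := by
  induction φ with
  | falsum => rfl
  | equal => simp only [toFormula, substAll, Term.equal, Term.bdEqual, Term.relabel_eq_subst]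
  | rel =>
    simp only [toFormula, substAll, Relations.formula, Relations.boundedFormula,
      Term.relabel_eq_subst]
  | imp _ _ ih₁ ih₂ => simp only [toFormula, ih₁, ih₂, substAll]
  | @all k _ ih =>
    simp only [toFormula, substAll]
    refine congrArg all ?_
    -- In the body, `toFormula` first frees the quantified variable as well; the relabelling then
    -- binds it again.
    rw [relabel_eq_substAll, ih, substAll_substAll]
    congr 1
    refine funext_sum_last (fun a => ?_) (fun i => ?_) ?_
    · simp [Term.subst, liftSubst_inl, relabelAux]
    · rw [liftSubst_castSucc]
      simp [Term.subst, relabelAux]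
    · rw [liftSubst_last]
      simp [Term.subst, relabelAux]
      rfl

/-- `φ.close ts` substitutes the terms `ts` for the variables of `φ` still to be bound. -/
def close (φ : L.BoundedFormula ℕ k) (ts : Fin k → L.Term ℕ) : L.Formula ℕ :=
  φ.substAll (Sum.elim (fun a => Term.var (Sum.inl a)) fun i => (ts i).relabel Sum.inl)

theorem close_zero (φ : L.Formula ℕ) (ts : Fin 0 → L.Term ℕ) : close φ ts = φ := by
  refine Eq.trans ?_ φ.substAll_var
  unfold close
  congr 1
  funext x
  rcases x with _ | i
  · rfl
  · exact i.elim0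

theorem instantiate_eq_close (φ : L.BoundedFormula ℕ 1) (t : L.Term ℕ) :
    instantiate φ t = φ.close fun _ => t := by
  unfold instantiate close
  rw [subst_eq_substAll, toFormula_eq_substAll, substAll_substAll]
  congr 1
  funext x
  rcases x with _ | i <;> rfl

/-- This matches an instance of a closed universal formula with the longer tuple in the quantifier
case of the truth lemma. -/
theorem instantiate_substAll_liftSubst (φ : L.BoundedFormula ℕ (k + 1)) (ts : Fin k → L.Term ℕ)
    (t : L.Term ℕ) :
    instantiate (φ.substAll (liftSubst
      (Sum.elim (fun a => Term.var (Sum.inl a)) fun i => (ts i).relabel Sum.inl))) t =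
      φ.close (Fin.snoc ts t) := by
  rw [instantiate_eq_close]
  unfold close
  rw [substAll_substAll]
  congr 1
  refine funext_sum_last (fun a => ?_) (fun i => ?_) ?_
  · simp [liftSubst_inl, Term.subst]
  · rw [liftSubst_castSucc]
    simp [Term.relabel_eq_subst, Term.subst_subst, Term.subst]
  · rw [liftSubst_last]
    simp [Term.subst]

end BoundedFormula

end FirstOrder.Language

/-! ### The completeness theorem by Henkin's method -/

namespace FirstOrder.Language

universe u v

variable {L : Language.{u, v}}

/-! ### Propositional derivations -/

namespace Derivable

variable {T : L.Theory} {φ χ θ : L.Formula ℕ}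

theorem imp_mp (h : Derivable T (φ.imp (χ.imp θ))) (h' : Derivable T (φ.imp χ)) :
    Derivable T (φ.imp θ) :=
  modusPonens _ _ (modusPonens _ _ (implyS _ _ _) h) h'

theorem imp_of (φ : L.Formula ℕ) (h : Derivable T χ) : Derivable T (φ.imp χ) :=
  modusPonens _ _ (implyK _ _) h

theorem imp_self (φ : L.Formula ℕ) : Derivable T (φ.imp φ) :=
  imp_mp (implyK φ (φ.imp φ)) (implyK φ φ)

theorem imp_trans (h : Derivable T (φ.imp χ)) (h' : Derivable T (χ.imp θ)) :
    Derivable T (φ.imp θ) :=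
  imp_mp (imp_of _ h') h

theorem contrapose (h : Derivable T (φ.imp χ)) : Derivable T (χ.not.imp φ.not) :=
  imp_mp (imp_trans (implyK χ.not φ) (implyS φ χ ⊥)) (imp_of _ h)

theorem bot_imp (φ : L.Formula ℕ) :
    Derivable T (BoundedFormula.imp (⊥ : L.Formula ℕ) φ) :=
  imp_trans (implyK _ _) (doubleNeg φ)

theorem not_imp_imp (φ χ : L.Formula ℕ) : Derivable T (φ.not.imp (φ.imp χ)) :=
  modusPonens _ _ (implyS φ ⊥ χ) (imp_of φ (bot_imp χ))

theorem not_imp_left (φ χ : L.Formula ℕ) : Derivable T ((φ.imp χ).not.imp φ) :=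
  imp_trans (contrapose (not_imp_imp φ χ)) (doubleNeg φ)

theorem not_imp_right (φ χ : L.Formula ℕ) : Derivable T ((φ.imp χ).not.imp χ.not) :=
  contrapose (implyK χ φ)

end Derivable

/-! ### Maximal consistent Henkin sets -/

/-- `H` is a maximal consistent set of formulas, closed under derivability from `T`, in which every
universal formula that fails has a variable as a counterexample. -/
structure IsHenkin (T : L.Theory) (H : Set (L.Formula ℕ)) : Prop where
  mem_of_derivable : ∀ {φ}, Derivable T φ → φ ∈ H
  mem_of_imp_mem : ∀ {φ χ : L.Formula ℕ}, φ.imp χ ∈ H → φ ∈ H → χ ∈ H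
  bot_notMem : (⊥ : L.Formula ℕ) ∉ H
  mem_or_not_mem : ∀ φ : L.Formula ℕ, φ ∈ H ∨ φ.not ∈ H
  all_mem_or : ∀ φ : L.BoundedFormula ℕ 1,
    φ.all ∈ H ∨ ∃ k : ℕ, (instantiate φ (Term.var k)).not ∈ H

section Extension

variable (T : L.Theory)

/-- The formulas that are consistent with `T`. -/
def ConsistentFormula : Type (max u v) := { χ : L.Formula ℕ // ¬ Derivable T χ.not }

/-- Consistent formulas are ordered by strength: the larger formula implies the smaller one. -/
instance : Preorder (ConsistentFormula T) where
  le χ χ' := Derivable T (χ'.1.imp χ.1)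
  le_refl χ := Derivable.imp_self χ.1
  le_trans _ _ _ h h' := Derivable.imp_trans h' h

variable {T}

/-- The formula `¬(χ → φ)` implies both `χ` and `¬φ`, and a refutation of it would yield `χ → φ`.
This is the density argument behind both cofinal families below. -/
theorem ConsistentFormula.exists_ge_imp_not (χ : ConsistentFormula T) {φ : L.Formula ℕ}
    (h : ¬ Derivable T (χ.1.imp φ)) :
    ∃ χ' : ConsistentFormula T, χ ≤ χ' ∧ Derivable T (χ'.1.imp φ.not) :=
  ⟨⟨(χ.1.imp φ).not, fun hn => h (.modusPonens _ _ (.doubleNeg _) hn)⟩,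
    Derivable.not_imp_left _ _, Derivable.not_imp_right _ _⟩

variable (T) in
/-- The consistent formulas that decide `φ`. -/
def decidingCofinal (φ : L.Formula ℕ) : Order.Cofinal (ConsistentFormula T) where
  carrier := { χ | Derivable T (χ.1.imp φ) ∨ Derivable T (χ.1.imp φ.not) }
  isCofinal χ := by
    by_cases h : Derivable T (χ.1.imp φ)
    · exact ⟨χ, Or.inl h, le_rfl⟩
    · obtain ⟨χ', h₁, h₂⟩ := χ.exists_ge_imp_not h
      exact ⟨χ', Or.inr h₂, h₁⟩

variable (T) in
/-- The consistent formulas that imply `∀ x φ(x)` or refute an instance `φ(xₖ)`. -/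
def witnessingCofinal (φ : L.BoundedFormula ℕ 1) : Order.Cofinal (ConsistentFormula T) where
  carrier := { χ | Derivable T (χ.1.imp φ.all) ∨
    ∃ k : ℕ, Derivable T (χ.1.imp (instantiate φ (Term.var k)).not) }
  isCofinal χ := by
    by_cases h : Derivable T (χ.1.imp φ.all)
    · exact ⟨χ, Or.inl h, le_rfl⟩
    -- For a fresh variable `xₖ`, a proof of `χ → φ(xₖ)` would generalize to `χ → ∀ x φ(x)`.
    · obtain ⟨k, hk⟩ := Infinite.exists_notMem_finset (χ.1.freeVarFinset ∪ φ.freeVarFinset)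
      rw [Finset.notMem_union] at hk
      obtain ⟨χ', h₁, h₂⟩ := χ.exists_ge_imp_not fun h' => h (.allIntro _ _ k hk.1 hk.2 h')
      exact ⟨χ', Or.inr ⟨k, h₂⟩, h₁⟩

/-- Every consistent formula belongs to a Henkin set. -/
theorem exists_isHenkin [Countable L.Symbols] (p : ConsistentFormula T) :
    ∃ H : Set (L.Formula ℕ), IsHenkin T H ∧ p.1 ∈ H := by
  have : Countable (L.BoundedFormula ℕ 1) :=
    Function.Injective.countable (f := fun φ => (⟨1, φ⟩ : Σ n, L.BoundedFormula ℕ n))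
      sigma_mk_injective
  let _ : Encodable (L.Formula ℕ ⊕ L.BoundedFormula ℕ 1) := Encodable.ofCountable _
  let D := Sum.elim (decidingCofinal T) (witnessingCofinal T)
  -- Rasiowa–Sikorski: the requirements are countably many, so one ideal containing `p` meets them
  -- all. Its consequences form the Henkin set; fresh variables serve as witnesses, so no constants
  -- are added.
  let I := Order.idealOfCofinals p D
  refine ⟨{ φ | ∃ χ ∈ I, Derivable T (χ.1.imp φ) },
    ⟨fun h => ?_, ?_, ?_, fun φ => ?_, fun φ => ?_⟩, ?_⟩
  · exact ⟨p, Order.mem_idealOfCofinals p D, Derivable.imp_of _ h⟩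
  · rintro φ χ ⟨a, ha, ha'⟩ ⟨b, hb, hb'⟩
    obtain ⟨c, hc, hac, hbc⟩ := I.directed a ha b hb
    exact ⟨c, hc, Derivable.imp_mp (Derivable.imp_trans hac ha') (Derivable.imp_trans hbc hb')⟩
  · rintro ⟨a, -, ha⟩
    exact a.2 ha
  · obtain ⟨χ, h | h, hχ⟩ := Order.cofinal_meets_idealOfCofinals p D (Sum.inl φ)
    · exact Or.inl ⟨χ, hχ, h⟩
    · exact Or.inr ⟨χ, hχ, h⟩
  · obtain ⟨χ, h | ⟨k, h⟩, hχ⟩ := Order.cofinal_meets_idealOfCofinals p D (Sum.inr φ)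
    · exact Or.inl ⟨χ, hχ, h⟩
    · exact Or.inr ⟨k, χ, hχ, h⟩
  · exact ⟨p, Order.mem_idealOfCofinals p D, Derivable.imp_self _⟩

end Extension

/-! ### The term model of a Henkin set -/

namespace BoundedFormula

variable {n : ℕ}

theorem subst_close_eq (t : L.Term (ℕ ⊕ Fin n)) (ts : Fin n → L.Term ℕ) :
    t.subst (Sum.elim (fun a => Term.var (Sum.inl a)) fun i => (ts i).relabel Sum.inl) =
      (t.subst (Sum.elim Term.var ts)).relabel (Sum.inl : ℕ → ℕ ⊕ Fin 0) := by
  rw [Term.relabel_eq_subst, Term.subst_subst]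
  congr 1
  funext x
  rcases x with _ | i
  · rfl
  · exact Term.relabel_eq_subst _ _

theorem close_equal (t₁ t₂ : L.Term (ℕ ⊕ Fin n)) (ts : Fin n → L.Term ℕ) :
    (equal t₁ t₂).close ts =
      (t₁.subst (Sum.elim Term.var ts)).equal (t₂.subst (Sum.elim Term.var ts)) := by
  simp only [close, substAll, subst_close_eq]
  rfl

theorem close_rel {l : ℕ} (R : L.Relations l) (us : Fin l → L.Term (ℕ ⊕ Fin n))
    (ts : Fin n → L.Term ℕ) :
    (rel R us).close ts = R.formula fun i => (us i).subst (Sum.elim Term.var ts) := by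
  simp only [close, substAll, subst_close_eq]
  rfl

theorem subst_relabel_inl (t : L.Term ℕ) (ts : Fin n → L.Term ℕ) :
    (t.relabel Sum.inl).subst (Sum.elim Term.var ts) = t := by
  rw [Term.relabel_eq_subst, Term.subst_subst]
  exact t.subst_var

/-- This isolates one place of a tuple, so that the one-variable axiom `eqSubst` applies to it. -/
theorem close_update (φ : L.BoundedFormula ℕ n) (ts : Fin n → L.Term ℕ) (i : Fin n) :
    ∃ ψ : L.BoundedFormula ℕ 1, ∀ t, instantiate ψ t = φ.close (Function.update ts i t) := by
  refine ⟨φ.substAll (Sum.elim (fun a => Term.var (Sum.inl a)) (Function.update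
    (fun j => (ts j).relabel Sum.inl) i (Term.var (Sum.inr 0)))), fun t => ?_⟩
  rw [instantiate_eq_close]
  unfold close
  rw [substAll_substAll]
  congr 1
  funext x
  rcases x with _ | j
  · rfl
  · rcases eq_or_ne j i with rfl | h
    · simp [Term.subst]
    · simp [h, Term.relabel_eq_subst, Term.subst_subst, Term.subst]

end BoundedFormula

namespace IsHenkin

variable {T : L.Theory} {H : Set (L.Formula ℕ)} (hH : IsHenkin T H)

include hH

theorem imp_mem_iff (φ χ : L.Formula ℕ) : φ.imp χ ∈ H ↔ (φ ∈ H → χ ∈ H) := by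
  refine ⟨hH.mem_of_imp_mem, fun h => ?_⟩
  rcases hH.mem_or_not_mem φ with hφ | hφ
  · exact hH.mem_of_imp_mem (hH.mem_of_derivable (.implyK _ _)) (h hφ)
  · exact hH.mem_of_imp_mem (hH.mem_of_derivable (.not_imp_imp _ _)) hφ

theorem all_mem_iff (φ : L.BoundedFormula ℕ 1) : φ.all ∈ H ↔ ∀ t, instantiate φ t ∈ H := by
  refine ⟨fun h t => hH.mem_of_imp_mem (hH.mem_of_derivable (.allElim _ _)) h, fun h => ?_⟩
  rcases hH.all_mem_or φ with h' | ⟨k, h'⟩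
  · exact h'
  · exact absurd (hH.mem_of_imp_mem h' (h _)) hH.bot_notMem

theorem instantiate_mem {s t : L.Term ℕ} (h : s.equal t ∈ H) (φ : L.BoundedFormula ℕ 1)
    (h' : instantiate φ s ∈ H) : instantiate φ t ∈ H :=
  hH.mem_of_imp_mem (hH.mem_of_imp_mem (hH.mem_of_derivable (.eqSubst φ s t)) h) h'

/-- The entries are exchanged one at a time, by induction on the set of places already exchanged. -/
theorem close_mem {n : ℕ} (φ : L.BoundedFormula ℕ n) {ts us : Fin n → L.Term ℕ}
    (h : ∀ i, (ts i).equal (us i) ∈ H) (hφ : φ.close ts ∈ H) : φ.close us ∈ H := by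
  classical
  have key (s : Finset (Fin n)) : φ.close (s.piecewise us ts) ∈ H := by
    induction s using Finset.induction_on with
    | empty => simpa using hφ
    | insert i s hi ih =>
      obtain ⟨ψ, hψ⟩ := φ.close_update (s.piecewise us ts) i
      rw [Finset.piecewise_insert, ← hψ]
      refine hH.instantiate_mem (h i) ψ ?_
      rwa [hψ, Function.update_eq_self_iff.2 (Finset.piecewise_eq_of_notMem _ _ _ hi).symm]
  simpa using key Finset.univ

theorem equal_symm {s t : L.Term ℕ} (h : s.equal t ∈ H) : t.equal s ∈ H := by
  -- Leibniz's law for the formula `x = s`, starting from `s = s`.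
  have := hH.close_mem (.equal (Term.var (Sum.inr 0)) (s.relabel Sum.inl) : L.BoundedFormula ℕ 1)
    (ts := fun _ => s) (us := fun _ => t) fun _ => h
  simp only [BoundedFormula.close_equal, BoundedFormula.subst_relabel_inl] at this
  exact this (hH.mem_of_derivable (.eqRefl s))

theorem equal_trans {s t r : L.Term ℕ} (h : s.equal t ∈ H) (h' : t.equal r ∈ H) :
    s.equal r ∈ H := by
  have := hH.close_mem (.equal (s.relabel Sum.inl) (Term.var (Sum.inr 0)) : L.BoundedFormula ℕ 1)
    (ts := fun _ => t) (us := fun _ => r) fun _ => h'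
  simp only [BoundedFormula.close_equal, BoundedFormula.subst_relabel_inl] at this
  exact this h

/-- Terms are identified if the Henkin set says that they are equal. -/
@[reducible] def termSetoid : Setoid (L.Term ℕ) where
  r s t := s.equal t ∈ H
  iseqv := ⟨fun t => hH.mem_of_derivable (.eqRefl t), hH.equal_symm, hH.equal_trans⟩

/-- The structure on the terms that induces the term model. -/
@[reducible] def termPrestructure : L.Prestructure hH.termSetoid where
  toStructure :=
    { funMap := Term.func
      RelMap := fun R ts => R.formula ts ∈ H }
  fun_equiv {n f} ts us h := by
    have := hH.close_mem (.equal ((Term.func f ts).relabel Sum.inl)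
      (Term.func f fun i => Term.var (Sum.inr i)) : L.BoundedFormula ℕ n) h
    simp only [BoundedFormula.close_equal, BoundedFormula.subst_relabel_inl] at this
    exact this (hH.mem_of_derivable (.eqRefl _))
  rel_equiv {n R} ts us h := by
    have key {ts us : Fin n → L.Term ℕ} (h : ∀ i, (ts i).equal (us i) ∈ H)
        (hR : R.formula ts ∈ H) : R.formula us ∈ H := by
      have := hH.close_mem (.rel R fun i => Term.var (Sum.inr i) : L.BoundedFormula ℕ n) h
      simp only [BoundedFormula.close_rel] at this
      exact this hR
    exact propext ⟨key h, key fun i => hH.equal_symm (h i)⟩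

/-- The term model. -/
def TermModel : Type u := Quotient hH.termSetoid

instance : L.Structure hH.TermModel :=
  let _ := hH.termPrestructure
  inferInstanceAs (L.Structure (Quotient hH.termSetoid))

/-- The class of a term in the term model. -/
def toModel (t : L.Term ℕ) : hH.TermModel := Quotient.mk hH.termSetoid t

theorem toModel_eq_iff {s t : L.Term ℕ} : hH.toModel s = hH.toModel t ↔ s.equal t ∈ H :=
  Quotient.eq (r := hH.termSetoid)

theorem realize_toModel {n : ℕ} (t : L.Term (ℕ ⊕ Fin n)) (ts : Fin n → L.Term ℕ) :
    t.realize (Sum.elim (fun k => hH.toModel (Term.var k)) fun i => hH.toModel (ts i)) =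
      hH.toModel (t.subst (Sum.elim Term.var ts)) := by
  induction t with
  | var x => rcases x with _ | _ <;> rfl
  | func f us ih =>
    simp only [Term.realize_func, ih]
    exact @funMap_quotient_mk' L _ hH.termSetoid hH.termPrestructure _ f _

/-- The truth lemma. -/
theorem realize_iff_mem {n : ℕ} (φ : L.BoundedFormula ℕ n) (ts : Fin n → L.Term ℕ) :
    φ.Realize (fun k => hH.toModel (Term.var k)) (fun i => hH.toModel (ts i)) ↔ φ.close ts ∈ H := by
  induction φ with
  | falsum => exact iff_of_false id hH.bot_notMem
  | equal t₁ t₂ => rw [BoundedFormula.close_equal, ← hH.toModel_eq_iff, ← realize_toModel, ← realize_toModel]; rfl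
  | rel R us =>
    rw [BoundedFormula.close_rel, BoundedFormula.Realize]
    simp only [realize_toModel]
    exact @relMap_quotient_mk' L _ hH.termSetoid hH.termPrestructure _ R _
  | imp _ _ ih₁ ih₂ =>
    rw [BoundedFormula.realize_imp, ih₁, ih₂]
    exact (hH.imp_mem_iff _ _).symm
  | all φ ih =>
    rw [BoundedFormula.realize_all]
    refine Iff.trans ?_ (hH.all_mem_iff _).symm
    simp only [BoundedFormula.instantiate_substAll_liftSubst, ← ih]
    have snoc (t : L.Term ℕ) :
        (fun i => hH.toModel (Fin.snoc (α := fun _ => L.Term ℕ) ts t i)) =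
          Fin.snoc (α := fun _ => hH.TermModel) (fun i => hH.toModel (ts i)) (hH.toModel t) := by
      funext i
      induction i using Fin.lastCases <;> simp
    simp only [snoc]
    -- Every element of the model is the class of a term.
    exact ⟨fun h t => h _, fun h => Quotient.ind h⟩

end IsHenkin

/-- **Gödel's completeness theorem** for sentences in a countable language. -/
theorem Theory.exists_model_of_not_proves [Countable L.Symbols] {T : L.Theory} {σ : L.Sentence}
    (h : ¬ T.Proves σ) :
    ∃ (M : Type u) (_ : L.Structure M), (∀ τ : L.Sentence, T.Proves τ → Sentence.Realize M τ) ∧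
      ¬ Sentence.Realize M σ := by
  -- `¬σ` is consistent with `T`, since `¬¬σ` would give `σ`.
  obtain ⟨H, hH, hσ⟩ := exists_isHenkin (T := T)
    ⟨(Formula.relabel Empty.elim σ : L.Formula ℕ).not, fun h' =>
      h (.modusPonens _ _ (.doubleNeg _) h')⟩
  have key (τ : L.Sentence) :
      Sentence.Realize hH.TermModel τ ↔ (Formula.relabel Empty.elim τ : L.Formula ℕ) ∈ H := by
    rw [← BoundedFormula.close_zero (Formula.relabel Empty.elim τ) default, ← hH.realize_iff_mem]
    have := Formula.realize_relabel (φ := τ) (g := (Empty.elim : Empty → ℕ))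
      (v := fun k => hH.toModel (Term.var k))
    rw [Formula.Realize] at this
    rw [Subsingleton.elim (fun i : Fin 0 => hH.toModel ((default : Fin 0 → L.Term ℕ) i)) default, this, Sentence.Realize,
      Subsingleton.elim (default : Empty → hH.TermModel)]
  refine ⟨hH.TermModel, inferInstance, fun τ hτ => (key τ).2 (hH.mem_of_derivable hτ), fun h' => ?_⟩
  exact hH.bot_notMem (hH.mem_of_imp_mem hσ ((key σ).1 h'))

end FirstOrder.Language

/-! ### Standard numbers and the `β` function in models of `Q` -/

namespace Arithmetic

open FirstOrder.Language

theorem countable_symbols : Countable arith.Symbols := by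
  let f : arith.Symbols → ℕ
    | Sum.inl ⟨_, Func.zero⟩ => 0
    | Sum.inl ⟨_, Func.succ⟩ => 1
    | Sum.inl ⟨_, Func.add⟩ => 2
    | Sum.inl ⟨_, Func.mul⟩ => 3
    | Sum.inr ⟨_, r⟩ => Empty.elim r
  refine Function.Injective.countable (f := f) ?_
  rintro (⟨_, _ | _ | _ | _⟩ | ⟨_, ⟨⟩⟩) (⟨_, _ | _ | _ | _⟩ | ⟨_, ⟨⟩⟩) h <;> first | rfl | cases h

/-! ### Models of Robinson's arithmetic -/

section Operations

variable {M : Type} [arith.Structure M]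

/-- The interpretation of `0`. -/
def zeroM : M := Structure.funMap (L := arith) Func.zero ![]

/-- The interpretation of the successor. -/
def succM (x : M) : M := Structure.funMap (L := arith) Func.succ ![x]

/-- The interpretation of addition. -/
def addM (x y : M) : M := Structure.funMap (L := arith) Func.add ![x, y]

/-- The interpretation of multiplication. -/
def mulM (x y : M) : M := Structure.funMap (L := arith) Func.mul ![x, y]

/-- The standard element `n` of a structure for the language of arithmetic. -/
def num : ℕ → M
  | 0 => zeroM
  | n + 1 => succM (num n)

/-- The order of a structure for the language of arithmetic. -/
def LeM (x y : M) : Prop := ∃ u, addM u x = y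

variable {α : Type} (v : α → M)

@[simp]
theorem realize_zeroT : (zeroT : arith.Term α).realize v = zeroM := by
  exact congrArg (Structure.funMap (L := arith) (M := M) Func.zero) (Subsingleton.elim _ _)

@[simp]
theorem realize_succT (t : arith.Term α) : (succT t).realize v = succM (t.realize v) := by
  refine congrArg (Structure.funMap (L := arith) Func.succ) (funext fun i => ?_)
  fin_cases i; rfl

@[simp]
theorem realize_addT (s t : arith.Term α) :
    (addT s t).realize v = addM (s.realize v) (t.realize v) := by
  refine congrArg (Structure.funMap (L := arith) Func.add) (funext fun i => ?_)
  fin_cases i <;> rfl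

@[simp]
theorem realize_mulT (s t : arith.Term α) :
    (mulT s t).realize v = mulM (s.realize v) (t.realize v) := by
  refine congrArg (Structure.funMap (L := arith) Func.mul) (funext fun i => ?_)
  fin_cases i <;> rfl

@[simp]
theorem realize_numeral (n : ℕ) : (numeral n : arith.Term α).realize v = num n := by
  induction n with
  | zero => exact realize_zeroT v
  | succ n ih => rw [numeral, realize_succT, ih, num]

end Operations

/-- The models of Robinson's arithmetic `Q`. -/
structure IsQModel (M : Type) [arith.Structure M] : Prop where
  succ_ne_zero : ∀ x : M, succM x ≠ zeroM
  succ_inj : ∀ x y : M, succM x = succM y → x = y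
  exists_succ : ∀ x : M, x ≠ zeroM → ∃ y, x = succM y
  add_zero : ∀ x : M, addM x zeroM = x
  add_succ : ∀ x y : M, addM x (succM y) = succM (addM x y)
  mul_zero : ∀ x : M, mulM x zeroM = zeroM
  mul_succ : ∀ x y : M, mulM x (succM y) = addM (mulM x y) x

theorem isQModel_of_realize {M : Type} [arith.Structure M]
    (h : ∀ σ ∈ robinsonQ, Sentence.Realize M σ) : IsQModel M := by
  simp only [robinsonQ, Set.mem_insert_iff, Set.mem_singleton_iff, forall_eq_or_imp, forall_eq,
    Sentence.Realize, Formula.Realize, BoundedFormula.realize_all, BoundedFormula.realize_not,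
    BoundedFormula.realize_bdEqual, realize_succT, realize_zeroT, realize_addT, realize_mulT,
    BoundedFormula.realize_imp, BoundedFormula.realize_ex] at h
  obtain ⟨h₁, h₂, h₃, h₄, h₅, h₆, h₇⟩ := h
  exact ⟨h₁, h₂, h₃, h₄, h₅, h₆, h₇⟩

theorem isQModel_nat : IsQModel ℕ where
  succ_ne_zero := Nat.succ_ne_zero
  succ_inj _ _ := Nat.succ.inj
  exists_succ x h := ⟨x - 1, (Nat.succ_pred_eq_of_ne_zero h).symm⟩
  add_zero _ := rfl
  add_succ _ _ := rfl
  mul_zero _ := rfl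
  mul_succ _ _ := rfl

namespace IsQModel

variable {M : Type} [arith.Structure M] (hM : IsQModel M)

include hM

theorem add_num (m n : ℕ) : addM (num m : M) (num n) = num (m + n) := by
  induction n with
  | zero => exact hM.add_zero _
  | succ n ih => rw [num, hM.add_succ, ih]; rfl

theorem mul_num (m n : ℕ) : mulM (num m : M) (num n) = num (m * n) := by
  induction n with
  | zero => exact hM.mul_zero _
  | succ n ih => rw [num, hM.mul_succ, ih, hM.add_num]; rfl

theorem num_inj {m n : ℕ} : (num m : M) = num n ↔ m = n := by
  refine ⟨fun h => ?_, fun h => h ▸ rfl⟩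
  induction m generalizing n with
  | zero =>
    cases n with
    | zero => rfl
    | succ n => exact absurd h.symm (hM.succ_ne_zero _)
  | succ m ih =>
    cases n with
    | zero => exact absurd h (hM.succ_ne_zero _)
    | succ n => rw [ih (hM.succ_inj _ _ h)]

/-- In `u + x = n` the recursion is on `x`, and a nonzero `x` has a predecessor; removing one
successor from each side lowers `n`, by induction outside the model. -/
theorem le_num_iff {x : M} {n : ℕ} : LeM x (num n) ↔ ∃ j ≤ n, x = num j := by
  constructor
  · rintro ⟨u, hu⟩
    induction n generalizing x with
    | zero =>
      by_cases hx : x = zeroM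
      · exact ⟨0, le_rfl, hx⟩
      · obtain ⟨y, rfl⟩ := hM.exists_succ x hx
        rw [hM.add_succ] at hu
        exact absurd hu (hM.succ_ne_zero _)
    | succ n ih =>
      by_cases hx : x = zeroM
      · exact ⟨0, Nat.zero_le _, hx⟩
      · obtain ⟨y, rfl⟩ := hM.exists_succ x hx
        rw [hM.add_succ] at hu
        obtain ⟨j, hj, rfl⟩ := ih (hM.succ_inj _ _ hu)
        exact ⟨j + 1, Nat.succ_le_succ hj, rfl⟩
  · rintro ⟨j, hj, rfl⟩
    exact ⟨num (n - j), by rw [hM.add_num, Nat.sub_add_cancel hj]⟩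

theorem num_le_num {m n : ℕ} : LeM (num m : M) (num n) ↔ m ≤ n := by
  rw [hM.le_num_iff]
  constructor
  · rintro ⟨j, hj, h⟩
    rwa [hM.num_inj.1 h]
  · exact fun h => ⟨m, h, rfl⟩

theorem succ_add_num (u : M) (n : ℕ) : addM (succM u) (num n) = addM u (num (n + 1)) := by
  induction n with
  | zero => rw [num, num, num, hM.add_zero, hM.add_succ, hM.add_zero]
  | succ n ih =>
    exact (hM.add_succ _ _).trans ((congrArg succM ih).trans (hM.add_succ _ _).symm)

/-- If `u + n = x`, then either `u = 0` and `x = n`, or `u = S y` and `y + (n + 1) = x`. -/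
theorem le_num_or_num_le (x : M) (n : ℕ) : LeM x (num n) ∨ LeM (num n) x := by
  induction n with
  | zero => exact Or.inr ⟨x, hM.add_zero x⟩
  | succ n ih =>
    rcases ih with h | ⟨u, hu⟩
    · obtain ⟨j, hj, rfl⟩ := hM.le_num_iff.1 h
      exact Or.inl (hM.num_le_num.2 (hj.trans (Nat.le_succ n)))
    · by_cases hu₀ : u = zeroM
      · refine Or.inl (hM.le_num_iff.2 ⟨n, Nat.le_succ n, ?_⟩)
        have := hM.add_num 0 n
        rw [Nat.zero_add] at this
        rw [← hu, hu₀]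
        exact this
      · obtain ⟨y, rfl⟩ := hM.exists_succ u hu₀
        exact Or.inr ⟨y, by rw [← hM.succ_add_num, hu]⟩

/-- Quantifiers with a standard bound see only standard elements, so bounded statements about
standard elements mean in `M` what they mean in `ℕ`. -/
theorem exists_le_num {P : M → Prop} {n : ℕ} :
    (∃ x, LeM x (num n) ∧ P x) ↔ ∃ j ≤ n, P (num j) := by
  simp only [hM.le_num_iff]
  constructor
  · rintro ⟨_, ⟨j, hj, rfl⟩, h⟩
    exact ⟨j, hj, h⟩
  · rintro ⟨j, hj, h⟩
    exact ⟨_, ⟨j, hj, rfl⟩, h⟩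

theorem forall_le_num {P : M → Prop} {n : ℕ} :
    (∀ x, LeM x (num n) → P x) ↔ ∀ j ≤ n, P (num j) := by
  simp only [hM.le_num_iff]
  constructor
  · exact fun h j hj => h _ ⟨j, hj, rfl⟩
  · rintro h _ ⟨j, hj, rfl⟩
    exact h j hj

end IsQModel

/-! ### An iteration, arithmetized with Gödel's `β` function -/

section Iteration

/-- The map on codes of terms `t ↦ S t`, for codes larger than `2`. -/
def step (z : ℕ) : ℕ := z * z + 2

/-- Gödel's `β` function codes the initial segments of every sequence. -/
theorem exists_mod_eq (g : ℕ → ℕ) (n : ℕ) :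
    ∃ a b, ∀ i ≤ n, a % ((i + 1) * b + 1) = g i := by
  let l := (List.range (n + 1)).map g
  refine ⟨(Nat.unbeta l).unpair.1, (Nat.unbeta l).unpair.2, fun i hi => ?_⟩
  refine (Nat.beta_unbeta_coe l ⟨i, ?_⟩).trans ?_
  · rw [List.length_map, List.length_range]
    omega
  · simp [l]

variable {M : Type} [arith.Structure M]

/-- `r` is the remainder of `a` modulo `(i + 1) b + 1`, with the quotient bounded by `w`. -/
def HasRem (w a b i r : M) : Prop :=
  ∃ q, LeM q w ∧ ∃ e, LeM e w ∧
    (addM r e = mulM (succM i) b ∧ a = addM (mulM q (succM (mulM (succM i) b))) r)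

/-- There is a sequence that starts with `8`, proceeds by `step` and has `z` at the place `x`;
its code is bounded by `w`. -/
def Trace (x z w : M) : Prop :=
  ∃ a, LeM a w ∧ ∃ b, LeM b w ∧ (HasRem w a b (num 0) (num 8) ∧ HasRem w a b x z ∧
    ∀ i, LeM i x → (i = x ∨ ∃ u, LeM u w ∧
      (HasRem w a b i u ∧ HasRem w a b (succM i) (addM (mulM u u) (num 2)))))

/-- `z` is `step^[x] 8`, phrased so that in every model of `Q` a standard `x` determines `z`. -/
def IsIter (x z : M) : Prop :=
  ∃ w, LeM z w ∧ Trace x z w ∧ ∀ w', LeM w' w → ∀ z', LeM z' w' → Trace x z' w' → z' = z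

theorem succM_num (n : ℕ) : succM (num n : M) = num (n + 1) := rfl

namespace IsQModel

variable (hM : IsQModel M)

include hM

theorem hasRem_num {w a b i r : ℕ} :
    HasRem (num w : M) (num a) (num b) (num i) (num r) ↔
      ∃ q ≤ w, ∃ e ≤ w, r + e = (i + 1) * b ∧ a = q * ((i + 1) * b + 1) + r := by
  simp only [HasRem, hM.exists_le_num, succM_num, hM.mul_num, hM.add_num, hM.num_inj]

theorem mod_eq_of_hasRem {w a b i r : ℕ}
    (h : HasRem (num w : M) (num a) (num b) (num i) (num r)) : a % ((i + 1) * b + 1) = r := by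
  obtain ⟨q, -, e, -, h, rfl⟩ := hM.hasRem_num.1 h
  rw [Nat.mul_add_mod_self_right]
  exact Nat.mod_eq_of_lt (by omega)

theorem hasRem_of_mod_eq {w a b i r : ℕ} (ha : a ≤ w) (hb : (i + 1) * b ≤ w)
    (h : a % ((i + 1) * b + 1) = r) :
    HasRem (num w : M) (num a) (num b) (num i) (num r) := by
  have hr : r < (i + 1) * b + 1 := h ▸ Nat.mod_lt _ (Nat.succ_pos _)
  refine hM.hasRem_num.2 ⟨a / ((i + 1) * b + 1), (Nat.div_le_self _ _).trans ha,
    (i + 1) * b - r, by omega, by omega, ?_⟩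
  rw [← h, mul_comm]
  exact (Nat.div_add_mod _ _).symm

theorem eq_iterate_of_trace {x z w : ℕ} (h : Trace (num x : M) (num z) (num w)) :
    z = step^[x] 8 := by
  simp only [Trace, hM.exists_le_num, hM.forall_le_num, succM_num, hM.mul_num, hM.add_num,
    hM.num_inj] at h
  obtain ⟨a, -, b, -, h₀, hx, hstep⟩ := h
  have key (i : ℕ) (hi : i ≤ x) : a % ((i + 1) * b + 1) = step^[i] 8 := by
    induction i with
    | zero => exact hM.mod_eq_of_hasRem h₀
    | succ i ih =>
      rcases hstep i (by omega) with h | ⟨u, -, h₁, h₂⟩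
      · omega
      · rw [Function.iterate_succ_apply', ← ih (by omega), hM.mod_eq_of_hasRem h₁,
          hM.mod_eq_of_hasRem h₂, step]
  rw [← key x le_rfl, hM.mod_eq_of_hasRem hx]

theorem exists_trace (x : ℕ) :
    ∃ w, step^[x] 8 ≤ w ∧ Trace (num x : M) (num (step^[x] 8)) (num w) := by
  obtain ⟨a, b, key⟩ := exists_mod_eq (fun i => step^[i] 8) x
  have hb (i : ℕ) (hi : i ≤ x) : (i + 1) * b ≤ a + (x + 1) * b :=
    (Nat.mul_le_mul_right b (by omega)).trans (Nat.le_add_left _ _)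
  have ha : a ≤ a + (x + 1) * b := Nat.le_add_right _ _
  have hle (i : ℕ) (hi : i ≤ x) : step^[i] 8 ≤ a + (x + 1) * b :=
    (key i hi ▸ Nat.mod_le _ _).trans ha
  -- This bound dominates `a`, `b` and all `(i + 1) * b` for `i ≤ x`, hence all quotients,
  -- remainders and entries.
  refine ⟨a + (x + 1) * b, hle x le_rfl, ?_⟩
  simp only [Trace, hM.exists_le_num, hM.forall_le_num, succM_num, hM.mul_num, hM.add_num,
    hM.num_inj]
  refine ⟨a, ha, b, by simpa using hb 0 (Nat.zero_le x), ?_, ?_, fun i hi => ?_⟩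
  · exact hM.hasRem_of_mod_eq ha (hb 0 (Nat.zero_le x)) (key 0 (Nat.zero_le x))
  · exact hM.hasRem_of_mod_eq ha (hb x le_rfl) (key x le_rfl)
  · rcases hi.eq_or_lt with h | h
    · exact Or.inl h
    · refine Or.inr ⟨step^[i] 8, hle i hi, hM.hasRem_of_mod_eq ha (hb i hi) (key i hi), ?_⟩
      refine hM.hasRem_of_mod_eq ha (hb (i + 1) h) ((key (i + 1) h).trans ?_)
      rw [Function.iterate_succ_apply', step]

/-- A Rosser-style argument. A bound `w` below the standard `w₀` is itself standard, and then the
trace is a genuine one. Otherwise `w₀ ≤ w`, and the uniqueness clause, applied to the genuine trace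
below `w₀`, forces the value of `z`. -/
theorem isIter_num_iff (x : ℕ) (z : M) : IsIter (num x) z ↔ z = num (step^[x] 8) := by
  obtain ⟨w₀, hw₀, htr⟩ := hM.exists_trace x
  constructor
  · rintro ⟨w, hz, hw, huniq⟩
    rcases hM.le_num_or_num_le w w₀ with h | h
    · obtain ⟨w, -, rfl⟩ := hM.le_num_iff.1 h
      obtain ⟨z, -, rfl⟩ := hM.le_num_iff.1 hz
      rw [hM.eq_iterate_of_trace hw]
    · exact (huniq _ h _ (hM.num_le_num.2 hw₀) htr).symm
  · rintro rfl
    refine ⟨num w₀, hM.num_le_num.2 hw₀, htr, fun w' hw' z' hz' h => ?_⟩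
    obtain ⟨w', -, rfl⟩ := hM.le_num_iff.1 hw'
    obtain ⟨z', -, rfl⟩ := hM.le_num_iff.1 hz'
    rw [hM.eq_iterate_of_trace h]

end IsQModel

end Iteration

end Arithmetic

/-! ### Arithmetization and the diagonal lemma -/

namespace Arithmetic

open FirstOrder.Language

/-! ### Formulas with named variables -/

section Named

/-- Make the free variable `xₖ` the variable of a quantifier to come. -/
def bindVar (k : ℕ) (φ : arith.Formula ℕ) : arith.BoundedFormula ℕ 1 :=
  BoundedFormula.relabel (n := 1) (k := 0) (fun j => if j = k then Sum.inr 0 else Sum.inl j) φ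

/-- `∃ xₖ ≤ t, φ`. -/
def exLe (k : ℕ) (t : arith.Term ℕ) (φ : arith.Formula ℕ) : arith.Formula ℕ :=
  (bindVar k
    ((addT (&0) ((Term.var k).relabel Sum.inl) =' t.relabel Sum.inl).ex ⊓ φ)).ex

/-- `∀ xₖ ≤ t, φ`. -/
def allLe (k : ℕ) (t : arith.Term ℕ) (φ : arith.Formula ℕ) : arith.Formula ℕ :=
  (exLe k t φ.not).not

variable {M : Type} [arith.Structure M] (v : ℕ → M)

theorem realize_bindVar (k : ℕ) (φ : arith.Formula ℕ) (xs : Fin 1 → M) :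
    (bindVar k φ).Realize v xs ↔ φ.Realize (Function.update v k (xs 0)) := by
  rw [bindVar, BoundedFormula.realize_relabel, Formula.Realize]
  refine iff_of_eq (congrArg₂ _ (funext fun j => ?_) (Subsingleton.elim _ _))
  by_cases h : j = k
  · subst h
    simp
  · simp [h]

theorem realize_ex_bindVar (k : ℕ) (φ : arith.Formula ℕ) :
    Formula.Realize (bindVar k φ).ex v ↔ ∃ x, φ.Realize (Function.update v k x) := by
  rw [Formula.Realize, BoundedFormula.realize_ex]
  simp only [realize_bindVar]
  rfl

theorem realize_le (s t : arith.Term ℕ) :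
    Formula.Realize (addT (&0) (s.relabel Sum.inl) =' t.relabel Sum.inl).ex v ↔
      LeM (s.realize v) (t.realize v) := by
  simp only [Formula.Realize, BoundedFormula.realize_ex, BoundedFormula.realize_bdEqual,
    realize_addT, Term.realize_relabel, Sum.elim_comp_inl, LeM]
  rfl

/-- The bound `t` lies in the scope of the quantifier, hence the updated assignment; in the formulas
below `xₖ` never occurs in `t`. -/
theorem realize_exLe (k : ℕ) (t : arith.Term ℕ) (φ : arith.Formula ℕ) :
    (exLe k t φ).Realize v ↔ ∃ x, LeM x (t.realize (Function.update v k x)) ∧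
      φ.Realize (Function.update v k x) := by
  rw [exLe, realize_ex_bindVar]
  simp only [Formula.realize_inf, realize_le, Term.realize_var, Function.update_self]

theorem realize_allLe (k : ℕ) (t : arith.Term ℕ) (φ : arith.Formula ℕ) :
    (allLe k t φ).Realize v ↔ ∀ x, LeM x (t.realize (Function.update v k x)) →
      φ.Realize (Function.update v k x) := by
  simp [allLe, realize_exLe, Formula.realize_not]

end Named

/-! ### The iteration is definable -/

section Definable

/-- The formula for `HasRem`, with `w`, `x₅`, `x₆` for `a`, `b`. -/
def hasRemF (w : ℕ) (i r : arith.Term ℕ) : arith.Formula ℕ :=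
  exLe 9 (.var w) (exLe 10 (.var w)
    ((addT r (.var 10)).equal (mulT (succT i) (.var 6)) ⊓
      Term.equal (.var 5) (addT (mulT (.var 9) (succT (mulT (succT i) (.var 6)))) r)))

/-- The formula for `Trace`, with `x₀`, `z`, `w` for its arguments. -/
def traceF (z w : ℕ) : arith.Formula ℕ :=
  exLe 5 (.var w) (exLe 6 (.var w) (hasRemF w (numeral 0) (numeral 8) ⊓
    (hasRemF w (.var 0) (.var z) ⊓ allLe 7 (.var 0) (Term.equal (.var 7) (.var 0) ⊔
      exLe 8 (.var w) (hasRemF w (.var 7) (.var 8) ⊓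
        hasRemF w (succT (.var 7)) (addT (mulT (.var 8) (.var 8)) (numeral 2)))))))

/-- The formula `∃ z, IsIter x z ∧ φ`, with `x₀`, `x₁` for `x`, `z`. -/
def exIterF (φ : arith.Formula ℕ) : arith.Formula ℕ :=
  (bindVar 1 ((bindVar 2 (exLe 3 (.var 2) (Term.equal (.var 3) (.var 1)) ⊓ (traceF 1 2 ⊓
    allLe 4 (.var 2) (allLe 3 (.var 4) ((traceF 3 4).imp
      (Term.equal (.var 3) (.var 1))))))).ex ⊓ φ)).ex

variable {M : Type} [arith.Structure M] (v : ℕ → M)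

/-- Indices below `5` avoid capture by the bound variables `x₅, …, x₁₀`. -/
theorem realize_traceF {z w : ℕ} (hz : z < 5) (hw : w < 5) :
    (traceF z w).Realize v ↔ Trace (v 0) (v z) (v w) := by
  have hz' {n : ℕ} (h : 5 ≤ n) : z ≠ n := by omega
  have hw' {n : ℕ} (h : 5 ≤ n) : w ≠ n := by omega
  simp [traceF, hasRemF, realize_exLe, realize_allLe, Trace, HasRem, hz', hw',
    Formula.realize_equal]

theorem realize_exIterF (φ : arith.Formula ℕ) :
    (exIterF φ).Realize v ↔ ∃ z, IsIter (v 0) z ∧ φ.Realize (Function.update v 1 z) := by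
  simp [exIterF, realize_ex_bindVar, realize_exLe, realize_allLe, IsIter, Formula.realize_equal,
    realize_traceF]

end Definable

/-! ### Gödel numbers of numerals and the diagonal lemma -/

/-- `Nat.pair` is defined by cases on which argument is larger; this bound settles the cases for the
codes below. -/
theorem add_eight_le_iterate_step (m : ℕ) : m + 8 ≤ step^[m] 8 := by
  induction m with
  | zero => exact le_rfl
  | succ m ih =>
    rw [Function.iterate_succ_apply', step]
    nlinarith

theorem termCode_numeral (n m : ℕ) :
    termCode (numeral (m + 1) : arith.Term (Empty ⊕ Fin n)) = step^[m] 8 := by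
  induction m with
  -- The numeral `0` has code `2`, and `Nat.pair 2 2 = 8` falls under the other case of `Nat.pair`;
  -- hence the iteration starts at the numeral of `1`.
  | zero => rfl
  | succ m ih =>
    rw [Function.iterate_succ_apply', ← ih, step]
    change Nat.pair 2 (termCode (numeral (m + 1) : arith.Term (Empty ⊕ Fin n))) = _
    rw [Nat.pair, if_pos]
    have := add_eight_le_iterate_step m
    omega

/-- The sentence `∀ x, S x = #(m + 1) → φ(x)`. -/
def specialize (φ : arith.BoundedFormula Empty 1) (m : ℕ) : arith.Sentence :=
  ∀' ((succT (&0) =' numeral (m + 1)) ⟹ φ)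

/-- The Gödel number of `specialize φ (code φ)`, from `code φ` and the Gödel number of the
numeral. -/
def diagCode (z m : ℕ) : ℕ :=
  -- `6` is the code of the bound variable, `a` that of the equation, and `b` that of the
  -- implication.
  let a := (z * z + 6) * (z * z + 6) + 1
  let b := (a * a + a + m) * (a * a + a + m) + 2
  b * b + 3

/-- The term for `diagCode`. -/
def diagTerm (z m : arith.Term ℕ) : arith.Term ℕ :=
  let c := addT (mulT z z) (numeral 6)
  let a := addT (mulT c c) (numeral 1)
  let d := addT (addT (mulT a a) a) m
  let b := addT (mulT d d) (numeral 2)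
  addT (mulT b b) (numeral 3)

theorem IsQModel.realize_diagTerm {M : Type} [arith.Structure M] (hM : IsQModel M) {v : ℕ → M}
    {s t : arith.Term ℕ} {z m : ℕ} (hs : s.realize v = num z) (ht : t.realize v = num m) :
    (diagTerm s t).realize v = num (diagCode z m) := by
  simp only [diagTerm, diagCode, realize_addT, realize_mulT, realize_numeral, hs, ht, hM.add_num,
    hM.mul_num]

theorem code_specialize (φ : arith.BoundedFormula Empty 1) (m : ℕ) (hφ : code φ = m) :
    code (specialize φ m) = diagCode (step^[m] 8) m := by
  have h : code (specialize φ m) = Nat.pair 3 (Nat.pair 2 (Nat.pair (Nat.pair 1 (Nat.pair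
      (Nat.pair 2 (Nat.pair 0 0))
      (termCode (numeral (m + 1) : arith.Term (Empty ⊕ Fin 1))))) (code φ))) := rfl
  have hle := add_eight_le_iterate_step m
  have h₆ : Nat.pair 2 (Nat.pair 0 0) = 6 := rfl
  rw [h, termCode_numeral, hφ, h₆]
  generalize step^[m] 8 = z at hle
  have h₁ : Nat.pair 6 z = z * z + 6 := if_pos (by omega)
  have h₂ : Nat.pair 1 (z * z + 6) = (z * z + 6) * (z * z + 6) + 1 := if_pos (by omega)
  rw [h₁, h₂, diagCode]
  have ha : m ≤ (z * z + 6) * (z * z + 6) + 1 := by nlinarith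
  have ha' : 2 ≤ (z * z + 6) * (z * z + 6) + 1 := by nlinarith
  generalize (z * z + 6) * (z * z + 6) + 1 = a at ha ha'
  have h₃ : Nat.pair a m = a * a + a + m := if_neg (by omega)
  have hd : 2 < a * a + a + m := by nlinarith
  rw [h₃]
  generalize a * a + a + m = d at hd
  have h₄ : Nat.pair 2 d = d * d + 2 := if_pos hd
  have h₅ : Nat.pair 3 (d * d + 2) = (d * d + 2) * (d * d + 2) + 3 := if_pos (by nlinarith)
  rw [h₄, h₅]

theorem exists_realize_iff_const (G : arith.Formula ℕ) :
    ∃ φ : arith.BoundedFormula Empty 1, ∀ (M : Type) [arith.Structure M] (x : M),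
      φ.Realize default (fun _ => x) ↔ G.Realize fun _ => x := by
  refine ⟨BoundedFormula.relabel (n := 1) (k := 0) (fun _ => Sum.inr 0) G, fun M _ x => ?_⟩
  rw [BoundedFormula.realize_relabel, Formula.Realize]
  exact iff_of_eq (congrArg₂ _ rfl (Subsingleton.elim _ _))

/-- Since the successor is injective, only `x = m` satisfies the premise. So this sentence does the
work of `φ(#m)`, and substitution need not be arithmetized. -/
theorem IsQModel.realize_specialize {M : Type} [arith.Structure M] (hM : IsQModel M)
    (φ : arith.BoundedFormula Empty 1) (m : ℕ) :
    Sentence.Realize M (specialize φ m) ↔ φ.Realize default fun _ => (num m : M) := by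
  have snoc (x : M) : (Fin.snoc (default : Fin 0 → M) x : Fin 1 → M) = fun _ => x :=
    funext fun i => by fin_cases i; rfl
  simp only [Sentence.Realize, Formula.Realize, specialize, BoundedFormula.realize_all,
    BoundedFormula.realize_imp, BoundedFormula.realize_bdEqual, realize_succT, realize_numeral,
    snoc]
  refine ⟨fun h => h _ rfl, fun h x hx => ?_⟩
  obtain rfl : x = num m := hM.succ_inj _ _ hx
  exact h

/-- **The diagonal lemma**: every arithmetical predicate has a fixed point, in all models of `Q`. -/
theorem exists_fixedPoint (E : arith.Formula (Fin 1)) :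
    ∃ ψ : arith.Sentence, ∀ (M : Type) [arith.Structure M], IsQModel M →
      (Sentence.Realize M ψ ↔ E.Realize fun _ => (num (code ψ) : M)) := by
  -- `φ(x)` says that `E` holds of `diagCode z x`, where `z` is the `x`-th iterate. At `x = code φ`
  -- this number is the code of the sentence `specialize φ x` itself.
  obtain ⟨φ, hφ⟩ := exists_realize_iff_const
    (exIterF (BoundedFormula.subst E fun _ => diagTerm (.var 1) (.var 0)))
  obtain ⟨m, hm⟩ : ∃ m, code φ = m := ⟨_, rfl⟩
  refine ⟨specialize φ m, fun M _ hM => ?_⟩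
  rw [code_specialize φ m hm, hM.realize_specialize, hφ, realize_exIterF]
  simp only [hM.isIter_num_iff, exists_eq_left]
  generalize step^[m] 8 = z
  rw [Formula.Realize, BoundedFormula.realize_subst, Formula.Realize]
  have (i : Fin 1) := hM.realize_diagTerm (s := .var 1) (t := .var 0) (z := z) (m := m)
    (v := Function.update (fun _ => num m) 1 (num z)) (by simp) (by simp)
  rw [funext this]

end Arithmetic

/-! ### Self-reference in unsound theories and the equivalence -/

namespace Arithmetic

open FirstOrder.Language

theorem realize_apply {M : Type} [arith.Structure M] (Δ : arith.Formula (Fin 1))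
    (ψ : arith.Sentence) :
    Sentence.Realize M (apply Δ ψ) ↔ Δ.Realize fun _ => (num (code ψ) : M) := by
  rw [Sentence.Realize, Formula.Realize, apply, BoundedFormula.realize_subst, Formula.Realize]
  simp only [realize_numeral]

theorem realize_iff {M : Type} [arith.Structure M] (σ τ : arith.Sentence) :
    Sentence.Realize M (BoundedFormula.iff σ τ) ↔
      (Sentence.Realize M σ ↔ Sentence.Realize M τ) :=
  BoundedFormula.realize_iff

/-- A sentence asserts inside `T` that it is a `Δ` if it is equivalent to this in all models of
`Q` in which a given theorem of `T` holds. -/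
theorem assertsOfItself_of_realize {T : arith.Theory} (hQ : ExtendsQ T) {σ : arith.Sentence}
    (hσ : T.Proves σ) {Δ : arith.Formula (Fin 1)} {ψ : arith.Sentence}
    (h : ∀ (M : Type) [arith.Structure M], IsQModel M → Sentence.Realize M σ →
      (Sentence.Realize M ψ ↔ Δ.Realize fun _ => (num (code ψ) : M))) :
    AssertsOfItself T ψ Δ := by
  by_contra hn
  have := countable_symbols
  obtain ⟨M, _, hM, hM'⟩ := Theory.exists_model_of_not_proves hn
  rw [realize_iff, realize_apply] at hM'
  exact hM' (h M (isQModel_of_realize fun τ hτ => hM τ (hQ τ hτ)) (hM σ hσ))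

theorem realize_relabel_sentence {M α : Type} [arith.Structure M] (σ : arith.Sentence)
    (v : α → M) :
    (Formula.relabel Empty.elim σ : arith.Formula α).Realize v ↔ Sentence.Realize M σ := by
  rw [Formula.realize_relabel, Sentence.Realize, Subsingleton.elim (v ∘ Empty.elim) default]

/-- The conjunct `σ` is invisible in models of `T` but makes the fixed point of `σ ∧ Δ(x)` false in
`ℕ`. -/
theorem exists_assertsOfItself_not_isTrue {T : arith.Theory} (hQ : ExtendsQ T)
    {σ : arith.Sentence} (hσ : T.Proves σ) (hf : ¬ IsTrue σ) (Δ : arith.Formula (Fin 1)) :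
    ∃ ψ, AssertsOfItself T ψ Δ ∧ ¬ IsTrue ψ := by
  obtain ⟨ψ, hψ⟩ := exists_fixedPoint (Formula.relabel Empty.elim σ ⊓ Δ)
  simp only [Formula.realize_inf, realize_relabel_sentence] at hψ
  refine ⟨ψ, assertsOfItself_of_realize hQ hσ fun M _ hM hMσ => ?_, fun h => ?_⟩
  · rw [hψ M hM, and_iff_right hMσ]
  · exact hf ((hψ ℕ isQModel_nat).1 h).1

/-- Dually, the premise `σ` makes the fixed point of `σ → Θ(x)` vacuously true in `ℕ`. -/
theorem exists_assertsOfItself_isTrue {T : arith.Theory} (hQ : ExtendsQ T)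
    {σ : arith.Sentence} (hσ : T.Proves σ) (hf : ¬ IsTrue σ) (Θ : arith.Formula (Fin 1)) :
    ∃ ψ, AssertsOfItself T ψ Θ ∧ IsTrue ψ := by
  obtain ⟨ψ, hψ⟩ := exists_fixedPoint ((Formula.relabel Empty.elim σ).imp Θ)
  simp only [Formula.realize_imp, realize_relabel_sentence] at hψ
  refine ⟨ψ, assertsOfItself_of_realize hQ hσ fun M _ hM hMσ => ?_, ?_⟩
  · rw [hψ M hM, forall_prop_of_true hMσ]
  · exact (hψ ℕ isQModel_nat).2 fun h => absurd h hf

end Arithmetic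

theorem mainTheorem2 (T : Arithmetic.arith.Theory) (hcons : T.Consistent)
    (hQ : Arithmetic.ExtendsQ T) (Δ Θ : Arithmetic.arith.Formula (Fin 1))
    (hΔ : Arithmetic.SelfFulfilling T Δ) (hΘ : Arithmetic.SelfFalsifying T Θ) :
    List.TFAE
      [Arithmetic.Sound T,
       ∀ ψ : Arithmetic.arith.Sentence,
         Arithmetic.AssertsOfItself T ψ Δ → Arithmetic.IsTrue ψ,
       ∀ ψ : Arithmetic.arith.Sentence,
         Arithmetic.AssertsOfItself T ψ Θ → ¬ Arithmetic.IsTrue ψ] := by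
  tfae_have 1 → 2 := fun h ψ hψ =>
    ((Arithmetic.realize_iff ψ _).1 (h _ hψ)).2 (hΔ ψ hψ)
  tfae_have 1 → 3 := fun h ψ hψ hψ' =>
    hΘ ψ hψ (((Arithmetic.realize_iff ψ _).1 (h _ hψ)).1 hψ')
  tfae_have 2 → 1 := fun h σ hσ => by
    by_contra hf
    obtain ⟨ψ, hψ, hψ'⟩ := Arithmetic.exists_assertsOfItself_not_isTrue hQ hσ hf Δ
    exact hψ' (h ψ hψ)
  tfae_have 3 → 1 := fun h σ hσ => by
    by_contra hf
    obtain ⟨ψ, hψ, hψ'⟩ := Arithmetic.exists_assertsOfItself_isTrue hQ hσ hf Θ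
    exact h ψ hψ hψ'
  tfae_finish
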